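/- Let $\Theta$ and $X$ be Borel subsets of Polish metric spaces, with $\Theta$ totally bounded, and write $\mathcal M(S)$ for the Borel probability measures on $S$, with the weak topology and the Prokhorov metric. Let $P:\Theta\to\mathcal M(X)$, $\theta\mapsto P_\theta$, be an injective measurable model, dominated by a $\sigma$-finite measure, such that $P:\Theta\to P(\Theta)$ is an open map. For every prior $\pi'\in\mathcal M(\Theta)$ and every $n$ let $x^n\mapsto\pi'_{x^n}$ be a measurable version of the posterior given $n$ i.i.d. observations, such that for every $\theta$, for $P_\theta^n$-a.e. $x^n$, $\pi'_{x^n}\ll\pi'$ (as holds for posteriors given by Bayes' rule for densities). Put $\pi'_n(x^\infty)=\pi'_{x^n}$, and let $\pi'_*\mu^n$ be the law of $\pi'_{x^n}$ when $x^n\sim\mu^n$. Let $d_{tv}(\mu,\nu)=\sup_A|\mu(A)-\nu(A)|$, let $\alpha_\mu$ be the Ky Fan metric on $\mathcal M(\Theta)$-valued random variables on $(X^\infty,\mu^\infty)$, where $\mathcal M(\Theta)$ carries the Prokhorov metric, and let $d_{\mathcal M(X)}$, $d_{\mathcal M^2(\Theta)}$ be pseudometrics on $\mathcal M(X)$ and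 $\mathcal M(\mathcal M(\Theta))$. For $\rho>0$ and $\pi\in\mathcal M(\Theta)$ let $$\mathcal Z_\rho(\pi)=\{((\pi,P_\theta),(\pi',P_\theta)):\ \theta\in\Theta,\ d_{tv}(\pi,\pi')<\rho\}.$$ For $\varepsilon_1,\varepsilon_2>0$ call $(\delta_1,\delta_2)$ with $\delta_1,\delta_2>0$ *tolerances* for $(\varepsilon_1,\varepsilon_2)$ if for all $((\pi,\mu),(\pi',\mu'))\in\mathcal Z_\rho(\pi)$ with $d_{tv}(\pi,\pi')<\delta_1$ and $d_{\mathcal M(X)}(\mu,\mu')<\delta_2$ we have, for all large enough $n$, $$d_{\mathcal M^2(\Theta)}(\pi'_*\mu^n,\pi'_*\mu'^n)<\varepsilon_1\quad\text{and}\quad \alpha_\mu(\pi_n,\pi'_n)<\varepsilon_2 .$$ The inference is *qualitatively robust* with respect to $\mathcal Z_\rho(\pi)$ if all $\varepsilon_1,\varepsilon_2>0$ have tolerances. Let $\mathcal N_r(\Theta)$ be the least number of open balls of radius $r$, centred in $\Theta$, that cover $\Theta$. **Theorem.** Let $\pi$ have global Kullback–Leibler support, i.e. $\pi\{\theta':K(P_\theta,P_{\theta'})\le\varepsilon\}>0$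 for all $\theta\in\Theta$ and $\varepsilon>0$, and suppose that the inference is qualitatively robust with respect to $\mathcal Z_\rho(\pi)$ for some $\rho>0$. Let $\varepsilon_1>0$, $0<\varepsilon_2<1$, and let $(\delta_1,\delta_2)$ be tolerances for $(\varepsilon_1,\varepsilon_2)$. Then for every $\varepsilon>\varepsilon_2$ with $\mathcal N_{2\varepsilon}(\Theta)\ge2$: 1. $\displaystyle \min(\delta_1,\rho)\le\frac1{\mathcal N_{2\varepsilon}(\Theta)}$; 2. if moreover all perturbations of size less than $\delta_1$ are admissible, i.e. $d_{tv}(\pi,\pi')<\delta_1$ implies $((\pi,P_\theta),(\pi',P_\theta))\in\mathcal Z_\rho(\pi)$ for all $\pi'\in\mathcal M(\Theta)$ and $\theta\in\Theta$, then $$\delta_1\le\min\Bigl(\frac1{\mathcal N_{2\varepsilon}(\Theta)},\rho\Bigr).$$ -/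

import Mathlib

open MeasureTheory Filter
open scoped ENNReal

namespace BayesRobust

noncomputable section

/-- A (finite, real-valued) pseudometric on a set. -/
structure IsPseudometric {S : Type*} (d : S → S → ℝ) : Prop where
  self : ∀ a, d a a = 0
  symm : ∀ a b, d a b = d b a
  triangle : ∀ a b c, d a c ≤ d a b + d b c

/-- Total variation distance `sup_A |μ(A) - ν(A)|`, over measurable sets `A`. -/
def tvDist {S : Type*} [MeasurableSpace S] (μ ν : ProbabilityMeasure S) : ℝ :=
  ⨆ A : {A : Set S // MeasurableSet A},
    |(μ : Measure S).real A.1 - (ν : Measure S).real A.1|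

/-- The Prokhorov metric on Borel probability measures. -/
def prokhorovDist {S : Type*} [PseudoMetricSpace S] [MeasurableSpace S]
    (μ ν : ProbabilityMeasure S) : ℝ :=
  levyProkhorovDist (μ : Measure S) (ν : Measure S)

/-- The Ky Fan distance `inf {e ≥ 0 : Q (d (Z, W) > e) ≤ e}` of two random variables on the
probability space `(Ω, Q)`, where `d` is the metric of their target space. -/
def kyFanDist {Ω S : Type*} [MeasurableSpace Ω] (Q : Measure Ω) (d : S → S → ℝ)
    (Z W : Ω → S) : ℝ :=
  sInf {e : ℝ | 0 ≤ e ∧ Q {ω | e < d (Z ω) (W ω)} ≤ ENNReal.ofReal e}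

/-- `N_r(Θ)`: the least number of open balls of radius `r`, centred in `Θ`, that cover `Θ`. -/
def coveringNumber (Θ : Type*) [PseudoMetricSpace Θ] (r : ℝ) : ℕ :=
  sInf {k : ℕ | ∃ s : Finset Θ, s.card = k ∧ (Set.univ : Set Θ) ⊆ ⋃ θ ∈ s, Metric.ball θ r}

section Model

variable {Θ X : Type*} [MeasurableSpace Θ] [MeasurableSpace X]

/-- The law `μ^n` of `n` i.i.d. samples. -/
def iidLaw (μ : ProbabilityMeasure X) (n : ℕ) : ProbabilityMeasure (Fin n → X) :=
  ⟨Measure.pi fun _ => (μ : Measure X), inferInstance⟩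

/-- The law `μ^∞` of an i.i.d. sequence. -/
def iidSeqLaw (μ : ProbabilityMeasure X) : Measure (ℕ → X) :=
  Measure.infinitePi fun _ => (μ : Measure X)

/-- The model is dominated by some σ-finite measure. -/
def IsDominated (P : Θ → ProbabilityMeasure X) : Prop :=
  ∃ ν : Measure X, SigmaFinite ν ∧ ∀ θ, (P θ : Measure X) ≪ ν

/-- The prior `π` has Kullback-Leibler support at `θ`. -/
def HasKLSupportAt (P : Θ → ProbabilityMeasure X) (π : ProbabilityMeasure Θ) (θ : Θ) : Prop :=
  ∀ ε : ℝ, 0 < ε → 0 < (π : Measure Θ)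
    {θ' | InformationTheory.klDiv (P θ : Measure X) (P θ' : Measure X) ≤ ENNReal.ofReal ε}

/-- The prior `π` has global Kullback-Leibler support. -/
def HasGlobalKLSupport (P : Θ → ProbabilityMeasure X) (π : ProbabilityMeasure Θ) : Prop :=
  ∀ θ, HasKLSupportAt P π θ

/-- A determination of the posteriors of the model `P`: for every prior `π` and every sample size
`n`, a measurable map `x ↦ π_x` into the space of probability measures which is a version of the
conditional distribution of the parameter given the sample, under the joint law
`π(dθ) P_θ^n(dx)`.

Conditional distributions are unique only up to sets of samples that are null for the marginal
`∫ P_θ^n dπ(θ)`. The last field settles what remains, as Bayes' rule for densities does: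
the posterior gives no mass to the null sets of the prior, also for samples from model
distributions that are not dominated by that marginal. (Posteriors `p(x|θ) π(dθ) / ∫ p(x|t) π(dt)`,
completed by the prior `π` where the denominator is `0` or `∞`, have all these properties.) -/
structure Posteriors (P : Θ → ProbabilityMeasure X) where
  post : ProbabilityMeasure Θ → (n : ℕ) → (Fin n → X) → ProbabilityMeasure Θ
  measurable_post : ∀ π n, Measurable (post π n)
  conditional : ∀ (π : ProbabilityMeasure Θ) (n : ℕ) (A : Set Θ) (B : Set (Fin n → X)),
    MeasurableSet A → MeasurableSet B →
      ∫⁻ θ in A, (iidLaw (P θ) n : Measure (Fin n → X)) B ∂(π : Measure Θ) =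
        ∫⁻ θ, ∫⁻ x in B, (post π n x : Measure Θ) A ∂(iidLaw (P θ) n : Measure (Fin n → X))
          ∂(π : Measure Θ)
  absolutelyContinuous : ∀ (π : ProbabilityMeasure Θ) (n : ℕ) (θ : Θ),
    ∀ᵐ x ∂(iidLaw (P θ) n : Measure (Fin n → X)), (post π n x : Measure Θ) ≪ (π : Measure Θ)

/-- The `M(Θ)`-valued random variable `π_n` on `X^∞`: the posterior given the first `n` samples. -/
def Posteriors.onSeq {P : Θ → ProbabilityMeasure X} (R : Posteriors P)
    (π : ProbabilityMeasure Θ) (n : ℕ) : (ℕ → X) → ProbabilityMeasure Θ :=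
  fun x => R.post π n fun i => x i

/-- `π_* μ^n`: the sampling distribution, in `M²(Θ)`, of the posterior of `π` when the sample has
law `μ^n`. (For separable metric `Θ` the measurable structure on `ProbabilityMeasure Θ` is the
Borel structure of the weak topology.) -/
def Posteriors.push {P : Θ → ProbabilityMeasure X} (R : Posteriors P)
    (π : ProbabilityMeasure Θ) (n : ℕ) (μ : ProbabilityMeasure X) :
    ProbabilityMeasure (ProbabilityMeasure Θ) :=
  (iidLaw μ n).map (R.measurable_post π n).aemeasurable

/-- `(δ₁, δ₂)` is a pair of tolerances for `(ε₁, ε₂)` in the definition of qualitative robustness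
with respect to the admissible set `Z` of pairs `((π, μ), (π', μ'))`, where the perturbations are
measured by `dΘ`, `dX` and the effects by `dΘΘ` on `M²(Θ)` and by `α μ` on random variables on
`(X^∞, μ^∞)`. -/
def IsTolerance {P : Θ → ProbabilityMeasure X} (R : Posteriors P)
    (dΘ : ProbabilityMeasure Θ → ProbabilityMeasure Θ → ℝ)
    (dX : ProbabilityMeasure X → ProbabilityMeasure X → ℝ)
    (dΘΘ : ProbabilityMeasure (ProbabilityMeasure Θ) →
      ProbabilityMeasure (ProbabilityMeasure Θ) → ℝ)
    (α : ProbabilityMeasure X → ((ℕ → X) → ProbabilityMeasure Θ) →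
      ((ℕ → X) → ProbabilityMeasure Θ) → ℝ)
    (Z : Set ((ProbabilityMeasure Θ × ProbabilityMeasure X) ×
      (ProbabilityMeasure Θ × ProbabilityMeasure X)))
    (ε₁ ε₂ δ₁ δ₂ : ℝ) : Prop :=
  ∀ π μ π' μ', ((π, μ), (π', μ')) ∈ Z → dΘ π π' < δ₁ → dX μ μ' < δ₂ →
    ∀ᶠ n in atTop, dΘΘ (R.push π' n μ) (R.push π' n μ') < ε₁ ∧
      α μ (R.onSeq π n) (R.onSeq π' n) < ε₂

/-- Qualitative robustness of the Bayesian inference with respect to `Z`. -/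
def QualitativelyRobust {P : Θ → ProbabilityMeasure X} (R : Posteriors P)
    (dΘ : ProbabilityMeasure Θ → ProbabilityMeasure Θ → ℝ)
    (dX : ProbabilityMeasure X → ProbabilityMeasure X → ℝ)
    (dΘΘ : ProbabilityMeasure (ProbabilityMeasure Θ) →
      ProbabilityMeasure (ProbabilityMeasure Θ) → ℝ)
    (α : ProbabilityMeasure X → ((ℕ → X) → ProbabilityMeasure Θ) →
      ((ℕ → X) → ProbabilityMeasure Θ) → ℝ)
    (Z : Set ((ProbabilityMeasure Θ × ProbabilityMeasure X) ×
      (ProbabilityMeasure Θ × ProbabilityMeasure X))) : Prop :=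
  ∀ ε₁ ε₂ : ℝ, 0 < ε₁ → 0 < ε₂ → ∃ δ₁ δ₂ : ℝ, 0 < δ₁ ∧ 0 < δ₂ ∧
    IsTolerance R dΘ dX dΘΘ α Z ε₁ ε₂ δ₁ δ₂

/-- `Z_ρ(π) = {π} × B^tv_ρ(π) × {(P_θ, P_θ) : θ ∈ Θ}`, as a set of pairs of pairs. -/
def admissibleSet (P : Θ → ProbabilityMeasure X) (ρ : ℝ) (π : ProbabilityMeasure Θ) :
    Set ((ProbabilityMeasure Θ × ProbabilityMeasure X) ×
      (ProbabilityMeasure Θ × ProbabilityMeasure X)) :=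
  {z | z.1.1 = π ∧ tvDist π z.2.1 < ρ ∧ ∃ θ, z.1.2 = P θ ∧ z.2.2 = P θ}

end Model

/-- The Ky Fan metric `α_μ` on `M(Θ)`-valued random variables on `(X^∞, μ^∞)`, where `M(Θ)` carries
the Prokhorov metric. -/
def posteriorKyFan {Θ X : Type*} [PseudoMetricSpace Θ] [MeasurableSpace Θ] [MeasurableSpace X]
    (μ : ProbabilityMeasure X) (Z W : (ℕ → X) → ProbabilityMeasure Θ) : ℝ :=
  kyFanDist (iidSeqLaw μ) prokhorovDist Z W

end

end BayesRobust

/-! A maximal packing argument gives N = `coveringNumber Θ (2 * ε)` points with disjoint `ε`-balls,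
so some ball around a `θ` has prior mass at most 1/N (`exists_ball_measureReal_le`). Conditioning
`π` on the complement of that ball gives `π'` within 1/N of `π` in total variation
(`exists_measure_eq_zero_tvDist_le`). Under samples from `P θ`, the posterior of `π` concentrates at
`θ`, while that of `π'` never charges the ball. So the two posteriors do not come within Ky Fan
distance `ε₂ < ε` for all large `n`, and the perturbation cannot be smaller than `min δ₁ ρ`. If `ρ <
δ₁`, a prior at total variation distance exactly `ρ` is inadmissible, which gives the second claim.

Concentration is Schwartz' theorem in probability. Exponential tests and Bayes' formula make the
event that the test accepts and the posterior is bad exponentially unlikely on prior average, hence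
under some `P θ'` with tiny divergence from `P θ`. The divergence of the n-fold products is at most
n times as large, so the event's probability under `P θ` is small too. -/

namespace BayesRobust

open ProbabilityTheory InformationTheory
open scoped Topology BoundedContinuousFunction


/-! ### Kullback–Leibler divergence: change of measure and products -/

section KullbackLeibler

variable {α β : Type*} [MeasurableSpace α] [MeasurableSpace β]

lemma klDiv_restrict_le (μ ν : Measure α) [IsFiniteMeasure μ] [IsFiniteMeasure ν]
    {s : Set α} (hs : MeasurableSet s) :
    klDiv (μ.restrict s) (ν.restrict s) ≤ klDiv μ ν := by
  by_cases h : μ ≪ ν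
  swap
  · simp [klDiv_of_not_ac h]
  have hr : μ.restrict s = (ν.restrict s).withDensity (μ.rnDeriv ν) := by
    rw [← restrict_withDensity hs, Measure.withDensity_rnDeriv_eq _ _ h]
  have hd : (μ.restrict s).rnDeriv (ν.restrict s) =ᵐ[ν.restrict s] μ.rnDeriv ν := by
    rw [hr]
    exact Measure.rnDeriv_withDensity _ (Measure.measurable_rnDeriv _ _)
  rw [klDiv_eq_lintegral_klFun_of_ac (h.restrict s), klDiv_eq_lintegral_klFun_of_ac h,
    lintegral_congr_ae (hd.mono fun x hx => by rw [hx])]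
  exact setLIntegral_le_lintegral _ _

/-- Jensen's inequality on `s` bounds μ(s) log(μ(s)/ν(s)) + ν(s) − μ(s) by `K`; the terms in μ(s)
alone cost at most 1, since x log x + 1 − x ≥ 0. An event exponentially small under `ν` thus cannot
be likely under `μ` when `K` is small compared with the exponent. -/
lemma measureReal_mul_neg_log_le (μ ν : Measure α) [IsProbabilityMeasure μ]
    [IsProbabilityMeasure ν] {s : Set α} (hs : MeasurableSet s) {K : ℝ} (hK0 : 0 ≤ K)
    (hK : klDiv μ ν ≤ ENNReal.ofReal K) (hν : 0 < ν.real s) :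
    μ.real s * -Real.log (ν.real s) ≤ K + 1 := by
  rcases (measureReal_nonneg (μ := μ) (s := s)).eq_or_lt with h0 | hμ
  · rw [← h0]
    linarith
  have h := ((mul_log_le_klDiv (μ.restrict s) (ν.restrict s)).trans
    (klDiv_restrict_le μ ν hs)).trans hK
  rw [ENNReal.ofReal_le_ofReal_iff hK0] at h
  simp only [measureReal_restrict_apply_univ] at h
  rw [Real.log_div hμ.ne' hν.ne'] at h
  have h1 := klFun_nonneg hμ.le
  rw [klFun_apply] at h1
  linarith

/-- The chain rule with constant kernels leaves the divergence of `μ.prod ν` from `μ.prod ν'`, which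
after swapping the factors equals that of `ν` from `ν'`. -/
lemma klDiv_prod_le (μ μ' : Measure α) (ν ν' : Measure β) [IsProbabilityMeasure μ]
    [IsProbabilityMeasure μ'] [IsProbabilityMeasure ν] [IsProbabilityMeasure ν'] :
    klDiv (μ.prod ν) (μ'.prod ν') ≤ klDiv μ μ' + klDiv ν ν' := by
  have h := klDiv_compProd_eq_add μ μ' (Kernel.const α ν) (Kernel.const α ν')
  have h2 := klDiv_compProd_left ν ν' (Kernel.const β μ)
  simp only [Measure.compProd_const] at h h2
  rw [h, ← h2, ← Measure.prod_swap (μ := ν) (ν := μ), ← Measure.prod_swap (μ := ν') (ν := μ)]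
  gcongr
  exact klDiv_map_le _ _ measurable_swap

lemma klDiv_pi_le (μ ν : Measure α) [IsProbabilityMeasure μ] [IsProbabilityMeasure ν] (n : ℕ) :
    klDiv (Measure.pi fun _ : Fin n => μ) (Measure.pi fun _ : Fin n => ν) ≤ n * klDiv μ ν := by
  induction n with
  | zero =>
    rw [Measure.pi_of_empty, Measure.pi_of_empty, klDiv_self]
    simp
  | succ n ih =>
    have h1 := (measurePreserving_piFinSuccAbove (fun _ : Fin (n + 1) => μ) 0).symm.map_eq
    have h2 := (measurePreserving_piFinSuccAbove (fun _ : Fin (n + 1) => ν) 0).symm.map_eq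
    rw [← h1, ← h2]
    calc _ ≤ _ := klDiv_map_le _ _ (MeasurableEquiv.measurable _)
      _ ≤ _ := klDiv_prod_le _ _ _ _
      _ ≤ klDiv μ ν + n * klDiv μ ν := by gcongr
      _ = _ := by push_cast; ring

end KullbackLeibler

/-! ### Exponentially consistent tests from Hoeffding's inequality -/

section Tests

variable {X : Type*} [MeasurableSpace X]

lemma iidLaw_hoeffding (ν : ProbabilityMeasure X) (n : ℕ) {f : X → ℝ} (hf : Measurable f) {B : ℝ}
    (hB : ∀ x, |f x| ≤ B) {s : ℝ} (hs : 0 ≤ s) :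
    (iidLaw ν n : Measure (Fin n → X)).real
      {x | n * s ≤ ∑ i, f (x i) - n * ∫ y, f y ∂(ν : Measure X)} ≤
      Real.exp (-(s ^ 2 / (2 * B ^ 2)) * n) := by
  set m := ∫ y, f y ∂(ν : Measure X) with hm
  have hind : iIndepFun (fun (i : Fin n) (x : Fin n → X) => f (x i) - m)
      (iidLaw ν n : Measure (Fin n → X)) :=
    iIndepFun_pi (X := fun _ y => f y - m) fun i => (hf.sub_const m).aemeasurable
  have hsub : ∀ i ∈ (Finset.univ : Finset (Fin n)),
      HasSubgaussianMGF (fun x : Fin n → X => f (x i) - m) ((‖B - -B‖₊ / 2) ^ 2)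
        (iidLaw ν n : Measure (Fin n → X)) := by
    intro i _
    have hmp : MeasurePreserving (Function.eval i) (iidLaw ν n : Measure (Fin n → X))
        (ν : Measure X) := measurePreserving_eval (fun _ : Fin n => (ν : Measure X)) i
    have h := hasSubgaussianMGF_of_mem_Icc (X := f) (μ := (ν : Measure X)) (a := -B) (b := B)
      hf.aemeasurable (ae_of_all _ fun x => abs_le.1 (hB x))
    rw [← hmp.map_eq] at h
    have h' := HasSubgaussianMGF.of_map hmp.measurable.aemeasurable h
    rw [hmp.map_eq] at h'
    exact h'
  have h := HasSubgaussianMGF.measure_sum_ge_le_of_iIndepFun hind hsub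
    (ε := n * s) (by positivity)
  refine le_trans (le_of_eq ?_) (h.trans (le_of_eq ?_))
  · simp [Finset.sum_sub_distrib]
  · congr 1
    have : ((‖B - -B‖₊ / 2 : NNReal) : ℝ) ^ 2 = B ^ 2 := by
      simp only [NNReal.coe_div, coe_nnnorm, Real.norm_eq_abs, NNReal.coe_ofNat]
      rw [div_pow, sq_abs]
      ring
    simp only [Finset.sum_const, Finset.card_univ, Fintype.card_fin, NNReal.coe_pow, this,
      nsmul_eq_mul, NNReal.coe_mul, NNReal.coe_natCast]
    -- For `n = 0` or `B = 0`, division by zero makes both exponents 0.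
    rcases eq_or_ne (n : ℝ) 0 with h0 | h0
    · simp [h0]
    rcases eq_or_ne B 0 with hB0 | hB0
    · simp [hB0]
    field_simp

lemma iidLaw_hoeffding_abs (ν : ProbabilityMeasure X) (n : ℕ) {f : X → ℝ} (hf : Measurable f)
    {B : ℝ} (hB : ∀ x, |f x| ≤ B) {s : ℝ} (hs : 0 ≤ s) :
    (iidLaw ν n : Measure (Fin n → X)).real
      {x | n * s ≤ |∑ i, f (x i) - n * ∫ y, f y ∂(ν : Measure X)|} ≤
      2 * Real.exp (-(s ^ 2 / (2 * B ^ 2)) * n) := by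
  have h1 := iidLaw_hoeffding ν n hf hB hs
  have h2 := iidLaw_hoeffding ν n hf.neg (B := B) (by simpa using hB) hs
  refine le_trans ((measureReal_mono ?_).trans (measureReal_union_le _ _))
    ((add_le_add h1 h2).trans_eq (two_mul _).symm)
  intro x hx
  rw [Set.mem_ofPred_eq] at hx
  rcases le_abs.1 hx with h | h
  · exact Or.inl h
  · right
    simp only [Set.mem_ofPred_eq, Pi.neg_apply, Finset.sum_neg_distrib, integral_neg]
    linarith

/-- There are tests of `μ₀` against the complement of `V` that are consistent under `μ₀` and have
uniformly exponentially small error probabilities on the complement of `V`. -/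
def HasExpTests (μ₀ : ProbabilityMeasure X) (V : Set (ProbabilityMeasure X)) : Prop :=
  ∃ c C : ℝ, 0 < c ∧ 0 < C ∧ ∃ A : ∀ n, Set (Fin n → X), (∀ n, MeasurableSet (A n)) ∧
    Tendsto (fun n => (iidLaw μ₀ n : Measure (Fin n → X)).real (A n)ᶜ) atTop (𝓝 0) ∧
    ∀ ν ∉ V, ∀ n, (iidLaw ν n : Measure (Fin n → X)).real (A n) ≤ C * Real.exp (-c * n)

/-- The sets against whose complement `μ₀` has exponentially consistent tests form a filter. -/
def expTestFilter (μ₀ : ProbabilityMeasure X) : Filter (ProbabilityMeasure X) where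
  sets := {V | HasExpTests μ₀ V}
  univ_sets := ⟨1, 1, one_pos, one_pos, fun _ => Set.univ, fun _ => MeasurableSet.univ, by simp,
    fun ν hν => absurd (Set.mem_univ ν) hν⟩
  sets_of_superset := by
    rintro V W ⟨c, C, hc, hC, A, hA, h0, h1⟩ hVW
    exact ⟨c, C, hc, hC, A, hA, h0, fun ν hν => h1 ν fun h => hν (hVW h)⟩
  inter_sets := by
    rintro V W ⟨c, C, hc, hC, A, hA, h0, h1⟩ ⟨c', C', hc', hC', A', hA', h0', h1'⟩
    -- Accept when both tests accept: a law outside the intersection is outside `V` or `W`, and that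
    -- one test rejects it.
    refine ⟨min c c', C + C', lt_min hc hc', by positivity, fun n => A n ∩ A' n,
      fun n => (hA n).inter (hA' n), ?_, fun ν hν n => ?_⟩
    · refine squeeze_zero (fun n => measureReal_nonneg) (fun n => ?_) (by simpa using h0.add h0')
      rw [Set.compl_inter]
      exact measureReal_union_le _ _
    · by_cases hV : ν ∈ V
      · have hW : ν ∉ W := fun hW => hν ⟨hV, hW⟩
        refine ((measureReal_mono Set.inter_subset_right).trans (h1' ν hW n)).trans ?_
        gcongr
        · linarith
        · exact min_le_right _ _
      · refine ((measureReal_mono Set.inter_subset_left).trans (h1 ν hV n)).trans ?_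
        gcongr
        · linarith
        · exact min_le_left _ _

/-- Accept when the empirical mean of `f` is within `r / 2` of its mean under `μ₀`. If the mean
under `ν` is at least `r` away, acceptance forces a deviation of at least `r / 2` from it. -/
lemma hasExpTests_integral (μ₀ : ProbabilityMeasure X) {f : X → ℝ} (hf : Measurable f) {B : ℝ}
    (hB0 : 0 < B) (hB : ∀ x, |f x| ≤ B) {r : ℝ} (hr : 0 < r) :
    HasExpTests μ₀
      {ν | |∫ y, f y ∂(ν : Measure X) - ∫ y, f y ∂(μ₀ : Measure X)| < r} := by
  set m₀ := ∫ y, f y ∂(μ₀ : Measure X) with hm₀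
  set c := (r / 2) ^ 2 / (2 * B ^ 2) with hc
  have hcpos : 0 < c := by positivity
  refine ⟨c, 2, hcpos, two_pos, fun n => {x | |∑ i, f (x i) - n * m₀| < n * (r / 2)}, fun n => ?_,
    ?_, fun ν hν n => ?_⟩
  · exact measurableSet_lt (by fun_prop) measurable_const
  · have hlim : Tendsto (fun n : ℕ => 2 * Real.exp (-c * n)) atTop (𝓝 0) := by
      have : Tendsto (fun n : ℕ => -c * (n : ℝ)) atTop atBot :=
        tendsto_natCast_atTop_atTop.const_mul_atTop_of_neg (by linarith)
      simpa using (Real.tendsto_exp_atBot.comp this).const_mul 2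
    refine squeeze_zero (fun n => measureReal_nonneg) (fun n => ?_) hlim
    refine le_trans (measureReal_mono ?_) (iidLaw_hoeffding_abs μ₀ n hf hB (half_pos hr).le)
    intro x hx
    simpa using hx
  · refine le_trans (measureReal_mono ?_) (iidLaw_hoeffding_abs ν n hf hB (half_pos hr).le)
    intro x hx
    simp only [Set.mem_ofPred_eq, not_lt] at hx hν ⊢
    have hn : (0 : ℝ) ≤ n := n.cast_nonneg
    have h1 : (n : ℝ) * r ≤ |n * ∫ y, f y ∂(ν : Measure X) - n * m₀| := by
      rw [← mul_sub, abs_mul, abs_of_nonneg hn]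
      exact mul_le_mul_of_nonneg_left hν hn
    have h2 := abs_sub_le (n * ∫ y, f y ∂(ν : Measure X)) (∑ i, f (x i)) (n * m₀)
    rw [abs_sub_comm] at h2
    rw [abs_sub_comm (n * ∫ y, f y ∂(ν : Measure X)) (∑ i, f (x i)),
      abs_sub_comm (n * m₀)] at h2
    linarith

/-- Since testable sets form a filter, the claim is that the identity converges weakly to `μ₀` along
it, which needs checking only on integrals of single bounded continuous functions. -/
lemma hasExpTests_of_mem_nhds [TopologicalSpace X] [OpensMeasurableSpace X]
    {μ₀ : ProbabilityMeasure X} {V : Set (ProbabilityMeasure X)} (hV : V ∈ 𝓝 μ₀) :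
    HasExpTests μ₀ V := by
  have h : Tendsto id (expTestFilter μ₀) (𝓝 μ₀) := by
    rw [ProbabilityMeasure.tendsto_iff_forall_integral_tendsto]
    intro f
    rw [Metric.tendsto_nhds]
    intro r hr
    refine hasExpTests_integral μ₀ f.continuous.measurable (B := ‖f‖ + 1) (by positivity)
      (fun x => ?_) hr
    exact (f.norm_coe_le_norm x).trans (by linarith)
  exact h hV

end Tests


/-! ### Posterior consistency -/

section Consistency

variable {Θ X : Type*} [MeasurableSpace Θ] [MeasurableSpace X]

lemma measurable_iidLaw_apply {P : Θ → ProbabilityMeasure X} (hP : Measurable P) (n : ℕ)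
    {E : Set (Fin n → X)} (hE : MeasurableSet E) :
    Measurable fun θ => (iidLaw (P θ) n : Measure (Fin n → X)) E := by
  have h : Measurable fun θ => (iidLaw (P θ) n : Measure (Fin n → X)) := by
    refine Measurable.measure_of_isPiSystem_of_isProbabilityMeasure generateFrom_pi.symm
      isPiSystem_pi ?_
    rintro _ ⟨t, ht, rfl⟩
    have hpi : ∀ θ, (iidLaw (P θ) n : Measure (Fin n → X)) (Set.univ.pi t) =
        ∏ i, (P θ : Measure X) (t i) := fun θ => Measure.pi_pi _ _
    simp_rw [hpi]
    refine Finset.measurable_prod _ fun i _ => ?_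
    exact (Measure.measurable_coe (ht i (Set.mem_univ i))).comp (measurable_subtype_coe.comp hP)
  exact (Measure.measurable_coe hE).comp h

lemma Posteriors.measurable_apply {P : Θ → ProbabilityMeasure X} (R : Posteriors P)
    (π : ProbabilityMeasure Θ) (n : ℕ) {U : Set Θ} (hU : MeasurableSet U) :
    Measurable fun x => (R.post π n x : Measure Θ) U :=
  (Measure.measurable_coe hU).comp (measurable_subtype_coe.comp (R.measurable_post π n))

/-- Bayes' formula turns the right side into an integral of the posterior mass of `U` over `A`;
Markov's inequality does the rest. -/
lemma Posteriors.lintegral_iidLaw_le {P : Θ → ProbabilityMeasure X} (R : Posteriors P)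
    (π : ProbabilityMeasure Θ) (n : ℕ) {U : Set Θ} (hU : MeasurableSet U)
    {A : Set (Fin n → X)} (hA : MeasurableSet A) (a : ℝ≥0∞) :
    a * ∫⁻ θ, (iidLaw (P θ) n : Measure (Fin n → X))
        (A ∩ {x | a ≤ (R.post π n x : Measure Θ) U}) ∂(π : Measure Θ) ≤
      ∫⁻ θ in U, (iidLaw (P θ) n : Measure (Fin n → X)) A ∂(π : Measure Θ) := by
  rw [R.conditional π n U A hU hA]
  refine (lintegral_const_mul_le _ _).trans (lintegral_mono fun θ => ?_)
  have hm := R.measurable_apply π n hU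
  have h := mul_meas_ge_le_lintegral₀
    (μ := (iidLaw (P θ) n : Measure (Fin n → X)).restrict A) hm.aemeasurable a
  rwa [Measure.restrict_apply (measurableSet_le measurable_const hm), Set.inter_comm] at h

lemma exists_measure_lt_of_lintegral_le (π : Measure Θ) [IsFiniteMeasure π] {q : Θ → ℝ≥0∞}
    (hq : Measurable q) {K : Set Θ} {κ b : ℝ} (hκ : 0 < κ) (hb : 0 < b) (hK : κ ≤ π.real K)
    (hint : ∫⁻ θ, q θ ∂π ≤ ENNReal.ofReal b) : ∃ θ ∈ K, q θ < ENNReal.ofReal (2 * b / κ) := by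
  by_contra! hcon
  have h1 := mul_meas_ge_le_lintegral₀ (μ := π) hq.aemeasurable (ENNReal.ofReal (2 * b / κ))
  have h2 : π K ≤ π {θ | ENNReal.ofReal (2 * b / κ) ≤ q θ} := measure_mono hcon
  have h3 : ENNReal.ofReal κ ≤ π K :=
    (ENNReal.ofReal_le_iff_le_toReal (measure_ne_top _ _)).2 hK
  have h4 : ENNReal.ofReal (2 * b / κ) * ENNReal.ofReal κ ≤ ENNReal.ofReal b :=
    ((mul_le_mul_right (h3.trans h2) _).trans h1).trans hint
  rw [← ENNReal.ofReal_mul (by positivity), ENNReal.ofReal_le_ofReal_iff hb.le,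
    div_mul_cancel₀ _ hκ.ne'] at h4
  linarith

/-- Schwartz' theorem on posterior consistency, with convergence in probability, for a set `U` of
parameters that contains all those whose distributions lie in a set `V` with exponentially
consistent tests. -/
theorem Posteriors.tendsto_measure_compl_of_hasExpTests {P : Θ → ProbabilityMeasure X}
    (R : Posteriors P) (hP : Measurable P) {π : ProbabilityMeasure Θ} {θ₀ : Θ}
    (hKL : HasKLSupportAt P π θ₀) {V : Set (ProbabilityMeasure X)} (hV : HasExpTests (P θ₀) V)
    {U : Set Θ} (hU : MeasurableSet U) (hUV : ∀ θ, P θ ∈ V → θ ∈ U) {a : ℝ} (ha : 0 < a) :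
    Tendsto (fun n => (iidLaw (P θ₀) n : Measure (Fin n → X)).real
      {x | ENNReal.ofReal a ≤ (R.post π n x : Measure Θ) Uᶜ}) atTop (𝓝 0) := by
  obtain ⟨c, C, hc, hC, A, hA, hA0, hA1⟩ := hV
  set G : ∀ n, Set (Fin n → X) := fun n => {x | ENNReal.ofReal a ≤ (R.post π n x : Measure Θ) Uᶜ}
  have hG : ∀ n, MeasurableSet (G n) := fun n =>
    measurableSet_le measurable_const (R.measurable_apply π n hU.compl)
  set p : ℕ → ℝ := fun n => (iidLaw (P θ₀) n : Measure (Fin n → X)).real (A n ∩ G n) with hp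
  suffices hp0 : Tendsto p atTop (𝓝 0) by
    refine squeeze_zero (fun n => measureReal_nonneg) (fun n => ?_) (by simpa using hp0.add hA0)
    refine (measureReal_mono ?_).trans (measureReal_union_le _ _)
    intro x hx
    by_cases hxA : x ∈ A n
    exacts [Or.inl ⟨hxA, hx⟩, Or.inr hxA]
  have hint : ∀ n, ∫⁻ θ, (iidLaw (P θ) n : Measure (Fin n → X)) (A n ∩ G n) ∂(π : Measure Θ) ≤
      ENNReal.ofReal (C * Real.exp (-c * n) / a) := by
    intro n
    have h1 := R.lintegral_iidLaw_le π n hU.compl (hA n) (ENNReal.ofReal a)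
    have h2 : ∫⁻ θ in Uᶜ, (iidLaw (P θ) n : Measure (Fin n → X)) (A n) ∂(π : Measure Θ) ≤
        ENNReal.ofReal (C * Real.exp (-c * n)) := by
      calc _ ≤ ∫⁻ θ in Uᶜ, ENNReal.ofReal (C * Real.exp (-c * n)) ∂(π : Measure Θ) := by
            refine setLIntegral_mono' hU.compl fun θ hθ => ?_
            rw [← ofReal_measureReal]
            exact ENNReal.ofReal_le_ofReal (hA1 _ (fun h => hθ (hUV θ h)) n)
        _ ≤ _ := by
            rw [setLIntegral_const]
            exact mul_le_of_le_one_right' prob_le_one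
    rw [ENNReal.ofReal_div_of_pos ha, ENNReal.le_div_iff_mul_le (by simp [ha]) (by simp), mul_comm]
    exact h1.trans h2
  rw [Metric.tendsto_atTop]
  intro t ht
  -- The bound `hkey` is asymptotically `p n ≤ η / c`, which is `t / 4`.
  set η := c * t / 4 with hη
  have hηpos : 0 < η := by positivity
  set K := {θ | klDiv (P θ₀ : Measure X) (P θ : Measure X) ≤ ENNReal.ofReal η} with hK
  set κ := (π : Measure Θ).real K with hκ
  have hκpos : 0 < κ := ENNReal.toReal_pos (hKL η hηpos).ne' (measure_ne_top _ _)
  set M := 2 * (C / a) / κ with hM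
  have hMpos : 0 < M := by positivity
  have hkey : ∀ n, p n * (c * n - Real.log M) ≤ n * η + 1 := by
    intro n
    -- This `θ` varies with `n`, but the divergence bound `η` and the constant `M` do not.
    obtain ⟨θ, hθK, hθ⟩ := exists_measure_lt_of_lintegral_le (π : Measure Θ)
      (measurable_iidLaw_apply hP n ((hA n).inter (hG n))) hκpos
      (b := C * Real.exp (-c * n) / a) (by positivity) le_rfl (hint n)
    set q := (iidLaw (P θ) n : Measure (Fin n → X)).real (A n ∩ G n) with hq
    have hqM : q ≤ M * Real.exp (-c * n) := by
      refine ENNReal.toReal_le_of_le_ofReal (by positivity) (hθ.le.trans_eq ?_)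
      congr 1
      rw [hM]
      field_simp
    have hkl : klDiv (iidLaw (P θ₀) n : Measure (Fin n → X)) (iidLaw (P θ) n : Measure (Fin n → X))
        ≤ ENNReal.ofReal (n * η) := by
      refine (klDiv_pi_le _ _ n).trans ?_
      rw [ENNReal.ofReal_mul n.cast_nonneg, ENNReal.ofReal_natCast]
      exact mul_le_mul_right hθK _
    have hp0 : 0 ≤ p n := measureReal_nonneg
    rcases (measureReal_nonneg : 0 ≤ q).eq_or_lt with hq0 | hqpos
    · have hac := (klDiv_ne_top_iff.1 (ne_top_of_le_ne_top ENNReal.ofReal_ne_top hkl)).1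
      have hpn : p n = 0 := by
        have : (iidLaw (P θ) n : Measure (Fin n → X)) (A n ∩ G n) = 0 :=
          (measureReal_eq_zero_iff).1 hq0.symm
        simp [hp, measureReal_def, hac this]
      rw [hpn, zero_mul]
      positivity
    · have h1 := measureReal_mul_neg_log_le _ _ ((hA n).inter (hG n)) (by positivity) hkl hqpos
      have h2 : Real.log q ≤ Real.log M + -c * n := by
        rw [← Real.log_exp (-c * n), ← Real.log_mul hMpos.ne' (Real.exp_ne_zero _)]
        exact Real.log_le_log hqpos hqM
      refine le_trans (mul_le_mul_of_nonneg_left ?_ hp0) h1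
      linarith
  -- The first bound makes the factor `c * n - log M` nonnegative; the second contradicts `hkey`
  -- when `p n ≥ t`.
  obtain ⟨N, hNn⟩ := exists_nat_gt (max (2 * (Real.log M) / c) (4 * (1 + t * Real.log M) / (c * t)))
  refine ⟨N, fun n hn => ?_⟩
  have hnR : (N : ℝ) ≤ n := by exact_mod_cast hn
  have h1 := ((le_max_left _ _).trans_lt hNn).trans_le hnR
  have h2 := ((le_max_right _ _).trans_lt hNn).trans_le hnR
  rw [div_lt_iff₀ hc] at h1
  rw [div_lt_iff₀ (by positivity)] at h2
  have hn0 : (0 : ℝ) ≤ n := n.cast_nonneg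
  rw [Real.dist_eq, sub_zero, abs_of_nonneg measureReal_nonneg]
  by_contra! hpt
  have hpos : 0 ≤ c * n - Real.log M := by nlinarith
  have h3 := (mul_le_mul_of_nonneg_right hpt hpos).trans (hkey n)
  have h4 : 0 ≤ c * t * n := by positivity
  rw [hη] at h3
  nlinarith

/-- Posterior consistency in probability for an injective model that is open onto its range. -/
theorem Posteriors.tendsto_measure_compl [TopologicalSpace Θ] [OpensMeasurableSpace Θ]
    [TopologicalSpace X] [OpensMeasurableSpace X] {P : Θ → ProbabilityMeasure X}
    (R : Posteriors P) (hP : Measurable P) (hP_inj : Function.Injective P)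
    (hP_open : IsOpenMap (Set.rangeFactorization P)) {π : ProbabilityMeasure Θ} {θ₀ : Θ}
    (hKL : HasKLSupportAt P π θ₀) {U : Set Θ} (hU : IsOpen U) (hθ₀ : θ₀ ∈ U) {a : ℝ} (ha : 0 < a) :
    Tendsto (fun n => (iidLaw (P θ₀) n : Measure (Fin n → X)).real
      {x | ENNReal.ofReal a ≤ (R.post π n x : Measure Θ) Uᶜ}) atTop (𝓝 0) := by
  -- Openness onto the range makes the image of `U` the trace of a weakly open `V`; by injectivity
  -- `U` is the whole preimage of `V`.
  obtain ⟨V, hVo, hV⟩ := isOpen_induced_iff.1 (hP_open U hU)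
  have hmem : ∀ θ, P θ ∈ V ↔ θ ∈ U := by
    intro θ
    have h : P θ ∈ V ↔ Set.rangeFactorization P θ ∈ Set.rangeFactorization P '' U := by
      rw [← hV]
      rfl
    rw [h, Function.Injective.mem_set_image]
    intro x y hxy
    exact hP_inj (congrArg Subtype.val hxy)
  exact R.tendsto_measure_compl_of_hasExpTests hP hKL
    (hasExpTests_of_mem_nhds (hVo.mem_nhds ((hmem θ₀).2 hθ₀))) hU.measurableSet
    (fun θ => (hmem θ).1) ha

end Consistency


/-! ### Perturbations of the prior in total variation -/

section TotalVariation

variable {S : Type*} [MeasurableSpace S]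

lemma tvDist_le {μ ν : ProbabilityMeasure S} {b : ℝ}
    (h : ∀ A, MeasurableSet A → |(μ : Measure S).real A - (ν : Measure S).real A| ≤ b) :
    tvDist μ ν ≤ b :=
  haveI : Nonempty {A : Set S // MeasurableSet A} := ⟨⟨∅, MeasurableSet.empty⟩⟩
  ciSup_le fun A => h A.1 A.2

lemma le_tvDist (μ ν : ProbabilityMeasure S) {A : Set S} (hA : MeasurableSet A) :
    |(μ : Measure S).real A - (ν : Measure S).real A| ≤ tvDist μ ν := by
  refine le_ciSup (f := fun A : {A : Set S // MeasurableSet A} =>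
    |(μ : Measure S).real A.1 - (ν : Measure S).real A.1|) ⟨1, ?_⟩ ⟨A, hA⟩
  rintro _ ⟨B, rfl⟩
  have h1 : (μ : Measure S).real B.1 ≤ 1 := measureReal_le_one
  have h2 : (ν : Measure S).real B.1 ≤ 1 := measureReal_le_one
  have h3 : 0 ≤ (μ : Measure S).real B.1 := measureReal_nonneg
  have h4 : 0 ≤ (ν : Measure S).real B.1 := measureReal_nonneg
  exact abs_le.2 ⟨by linarith, by linarith⟩

/-- Condition on `Bᶜ`. With β = π(B), the difference π(A) − π'(A) is π(A ∩ B) − β π'(A), and both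
terms lie in [0, β]. -/
lemma exists_measure_eq_zero_tvDist_le (π : ProbabilityMeasure S) {B : Set S}
    (hB : MeasurableSet B) (hB1 : (π : Measure S).real B < 1) :
    ∃ π' : ProbabilityMeasure S, (π' : Measure S) B = 0 ∧
      tvDist π π' ≤ (π : Measure S).real B := by
  have hc : (π : Measure S).real Bᶜ = 1 - (π : Measure S).real B := probReal_compl_eq_one_sub hB
  have hne : (π : Measure S) Bᶜ ≠ 0 := by
    intro h
    rw [measureReal_def, h, ENNReal.toReal_zero] at hc
    linarith
  have : IsProbabilityMeasure ((π : Measure S)[|Bᶜ]) := cond_isProbabilityMeasure hne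
  refine ⟨⟨(π : Measure S)[|Bᶜ], inferInstance⟩, ?_, tvDist_le fun A hA => ?_⟩
  · change ((π : Measure S)[|Bᶜ]) B = 0
    rw [cond_apply hB.compl]
    simp
  · change |(π : Measure S).real A - ((π : Measure S)[|Bᶜ]).real A| ≤ _
    rw [measureReal_def ((π : Measure S)[|Bᶜ]) A, cond_apply hB.compl, ENNReal.toReal_mul,
      ENNReal.toReal_inv, ← measureReal_def, ← measureReal_def, hc]
    have h1 : (π : Measure S).real (A ∩ B) + (π : Measure S).real (Bᶜ ∩ A) =
        (π : Measure S).real A := by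
      rw [Set.inter_comm, Set.inter_comm Bᶜ, ← Set.sdiff_eq, Set.inter_comm]
      exact measureReal_inter_add_sdiff hB
    set β := (π : Measure S).real B
    have h2 : (π : Measure S).real (A ∩ B) ≤ β := measureReal_mono Set.inter_subset_right
    have h3 : (π : Measure S).real (Bᶜ ∩ A) ≤ 1 - β :=
      (measureReal_mono Set.inter_subset_left).trans_eq hc
    have h4 : 0 ≤ (π : Measure S).real (A ∩ B) := measureReal_nonneg
    have h5 : 0 ≤ (π : Measure S).real (Bᶜ ∩ A) := measureReal_nonneg
    have hβ : 0 ≤ β := measureReal_nonneg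
    have hpos : 0 < 1 - β := by linarith
    set y := (π : Measure S).real (Bᶜ ∩ A)
    have h6 : (1 - β)⁻¹ * y = y + β * ((1 - β)⁻¹ * y) := by
      field_simp
      ring
    have h7 : (1 - β)⁻¹ * y ≤ 1 := by
      rw [inv_mul_le_iff₀ hpos]
      linarith
    have h8 : β * ((1 - β)⁻¹ * y) ≤ β := mul_le_of_le_one_right hβ h7
    have h9 : 0 ≤ β * ((1 - β)⁻¹ * y) := by positivity
    rw [← h1, h6]
    exact abs_le.2 ⟨by linarith, by linarith⟩

/-- The mixture (1 − t)μ + tν scales every difference on a set by `t`. -/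
lemma exists_tvDist_eq_mul (μ ν : ProbabilityMeasure S) {t : ℝ} (ht0 : 0 ≤ t) (ht1 : t ≤ 1) :
    ∃ μ' : ProbabilityMeasure S, tvDist μ μ' = t * tvDist μ ν := by
  set m : Measure S := ENNReal.ofReal (1 - t) • (μ : Measure S) + ENNReal.ofReal t • (ν : Measure S)
    with hm
  have hprob : IsProbabilityMeasure m := by
    constructor
    rw [hm]
    simp only [Measure.coe_add, Measure.coe_smul, Pi.add_apply, Pi.smul_apply, measure_univ,
      smul_eq_mul, mul_one]
    rw [← ENNReal.ofReal_add (by linarith) ht0]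
    simp
  refine ⟨⟨m, hprob⟩, ?_⟩
  have hreal : ∀ A : Set S,
      m.real A = (1 - t) * (μ : Measure S).real A + t * (ν : Measure S).real A := by
    intro A
    rw [measureReal_def, hm, Measure.add_apply, Measure.smul_apply, Measure.smul_apply, smul_eq_mul,
      smul_eq_mul, ENNReal.toReal_add (ENNReal.mul_ne_top ENNReal.ofReal_ne_top (measure_ne_top _ _))
        (ENNReal.mul_ne_top ENNReal.ofReal_ne_top (measure_ne_top _ _)), ENNReal.toReal_mul,
      ENNReal.toReal_mul, ENNReal.toReal_ofReal (by linarith), ENNReal.toReal_ofReal ht0]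
    rfl
  unfold tvDist
  rw [Real.mul_iSup_of_nonneg ht0]
  congr 1
  ext A
  change |(μ : Measure S).real A.1 - m.real A.1| = _
  rw [hreal, ← abs_of_nonneg ht0, ← abs_mul, abs_of_nonneg ht0]
  congr 1
  ring

/-- If `π` is not concentrated at `θ`, then every small number is a total variation distance
from `π`. -/
lemma exists_tvDist_eq [MeasurableSingletonClass S] (π : ProbabilityMeasure S) (θ : S) {ρ : ℝ}
    (hρ : 0 < ρ) (hθ : (π : Measure S).real {θ} + ρ ≤ 1) :
    ∃ π' : ProbabilityMeasure S, tvDist π π' = ρ := by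
  set ν : ProbabilityMeasure S := ⟨Measure.dirac θ, inferInstance⟩
  have h := le_tvDist π ν (measurableSet_singleton θ)
  have hν : (ν : Measure S).real {θ} = 1 := by
    change (Measure.dirac θ).real {θ} = 1
    simp [measureReal_def]
  rw [hν, abs_sub_comm] at h
  have h1 : ρ ≤ tvDist π ν := by
    refine le_trans ?_ ((le_abs_self _).trans h)
    linarith
  have hpos := hρ.trans_le h1
  obtain ⟨π', hπ'⟩ := exists_tvDist_eq_mul π ν (t := ρ / tvDist π ν) (by positivity)
    ((div_le_one hpos).2 h1)
  exact ⟨π', by rw [hπ', div_mul_cancel₀ _ hpos.ne']⟩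

end TotalVariation

/-! ### Packing and covering -/

section Packing

variable {Θ : Type*} [PseudoMetricSpace Θ]

/-- Greedy choice: fewer points than the covering number leave some point uncovered, and it can be
added. -/
lemma exists_separated_finset (r : ℝ) {k : ℕ} (hk : k ≤ coveringNumber Θ r) :
    ∃ s : Finset Θ, s.card = k ∧ (s : Set Θ).Pairwise fun x y => r ≤ dist x y := by
  classical
  induction k with
  | zero => exact ⟨∅, by simp⟩
  | succ k ih =>
    obtain ⟨s, hs, hsep⟩ := ih (by omega)
    have hcov : ¬ (Set.univ : Set Θ) ⊆ ⋃ θ ∈ s, Metric.ball θ r := fun h => by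
      have : coveringNumber Θ r ≤ k := Nat.sInf_le ⟨s, hs, h⟩
      omega
    obtain ⟨x, -, hx⟩ := Set.not_subset.1 hcov
    simp only [Set.mem_iUnion, Metric.mem_ball, not_exists, not_lt] at hx
    by_cases hxs : x ∈ s
    -- An uncovered point can already be in `s` only if `r ≤ 0`; then balls are empty, no cover
    -- exists, and the infimum takes its default value 0.
    · have hr : r ≤ 0 := by simpa using hx x hxs
      have h0 : coveringNumber Θ r = 0 := by
        refine Nat.sInf_eq_zero.2 (Or.inr ?_)
        refine Set.eq_empty_iff_forall_notMem.2 ?_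
        rintro m ⟨u, -, hu⟩
        obtain ⟨y, hy, hxy⟩ := Set.mem_iUnion₂.1 (hu (Set.mem_univ x))
        rw [Metric.ball_eq_empty.2 hr] at hxy
        exact hxy
      omega
    · refine ⟨insert x s, by rw [Finset.card_insert_of_notMem hxs, hs], ?_⟩
      rw [Finset.coe_insert]
      refine hsep.insert fun y hy _ => ⟨hx y hy, ?_⟩
      rw [dist_comm]
      exact hx y hy

lemma exists_ball_measureReal_le [MeasurableSpace Θ] [OpensMeasurableSpace Θ] (π : Measure Θ)
    [IsProbabilityMeasure π] {ε : ℝ} (hN : coveringNumber Θ (2 * ε) ≠ 0) :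
    ∃ θ, π.real (Metric.ball θ ε) ≤ 1 / (coveringNumber Θ (2 * ε) : ℝ) := by
  set N := coveringNumber Θ (2 * ε) with hNdef
  obtain ⟨s, hs, hsep⟩ := exists_separated_finset (Θ := Θ) (2 * ε) hNdef.le
  have hdisj : (s : Set Θ).PairwiseDisjoint fun θ => Metric.ball θ ε := fun x hx y hy hxy =>
    Metric.ball_disjoint_ball (by have := hsep hx hy hxy; linarith)
  have hsum : ∑ θ ∈ s, π.real (Metric.ball θ ε) ≤ 1 := by
    rw [← measureReal_biUnion_finset hdisj fun θ _ => Metric.isOpen_ball.measurableSet]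
    exact measureReal_le_one
  by_contra! hcon
  have hne : s.Nonempty := Finset.card_pos.1 (by omega)
  have h := Finset.sum_lt_sum_of_nonempty hne fun θ _ => hcon θ
  rw [Finset.sum_const, hs, nsmul_eq_mul, mul_one_div_cancel (by exact_mod_cast hN)] at h
  linarith

end Packing

/-! ### Separation of the posteriors in the Ky Fan metric -/

section KyFan

instance {X : Type*} [MeasurableSpace X] (μ : ProbabilityMeasure X) :
    IsProbabilityMeasure (iidSeqLaw μ) :=
  inferInstanceAs (IsProbabilityMeasure (Measure.infinitePi fun _ => (μ : Measure X)))

lemma iidSeqLaw_map {X : Type*} [MeasurableSpace X] (μ : ProbabilityMeasure X) (n : ℕ) :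
    (iidSeqLaw μ).map (fun x (i : Fin n) => x i) = (iidLaw μ n : Measure (Fin n → X)) := by
  have h : iIndepFun (fun (i : ℕ) (x : ℕ → X) => x i) (iidSeqLaw μ) :=
    iIndepFun_infinitePi (X := fun _ y => y) fun _ => measurable_id
  have h' := h.precomp (g := fun i : Fin n => (i : ℕ)) Fin.val_injective
  rw [iIndepFun_iff_map_fun_eq_pi_map (fun i => (measurable_pi_apply _).aemeasurable)] at h'
  refine h'.trans ?_
  change Measure.pi _ = Measure.pi _
  congr 1
  ext1 i
  exact Measure.infinitePi_map_eval _ _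

lemma exists_of_kyFanDist_lt {Ω S : Type*} [MeasurableSpace Ω] {Q : Measure Ω}
    [IsProbabilityMeasure Q] {d : S → S → ℝ} {Z W : Ω → S} {c : ℝ}
    (h : kyFanDist Q d Z W < c) :
    ∃ e, 0 ≤ e ∧ e < c ∧ Q {ω | e < d (Z ω) (W ω)} ≤ ENNReal.ofReal e := by
  obtain ⟨e, ⟨he0, he⟩, hec⟩ := exists_lt_of_csInf_lt
    (show {e : ℝ | 0 ≤ e ∧ Q {ω | e < d (Z ω) (W ω)} ≤ ENNReal.ofReal e}.Nonempty from
      ⟨1, zero_le_one, by simpa using prob_le_one⟩) h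
  exact ⟨e, he0, hec, he⟩

/-- The `c`-thickening of the `r`-ball lies in the `ν`-null ball, so only the additive error `c`
remains. -/
lemma measure_ball_le_of_prokhorovDist_lt {Θ : Type*} [PseudoMetricSpace Θ] [MeasurableSpace Θ]
    [OpensMeasurableSpace Θ] {μ ν : ProbabilityMeasure Θ} {c r : ℝ} (hc : 0 < c)
    (h : prokhorovDist μ ν < c) (θ : Θ) (hν : (ν : Measure Θ) (Metric.ball θ (c + r)) = 0) :
    (μ : Measure Θ) (Metric.ball θ r) ≤ ENNReal.ofReal c := by
  have h1 : levyProkhorovEDist (μ : Measure Θ) (ν : Measure Θ) < ENNReal.ofReal c :=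
    (ENNReal.lt_ofReal_iff_toReal_lt (levyProkhorovEDist_ne_top _ _)).2 h
  have h2 := left_measure_le_of_levyProkhorovEDist_lt h1
    (Metric.isOpen_ball (x := θ) (ε := r)).measurableSet
  rw [ENNReal.toReal_ofReal hc.le] at h2
  have h3 : (ν : Measure Θ) (Metric.thickening c (Metric.ball θ r)) = 0 :=
    measure_mono_null (Metric.thickening_ball _ _ _) hν
  rwa [h3, zero_add] at h2

variable {Θ X : Type*} [MetricSpace Θ] [MeasurableSpace Θ] [OpensMeasurableSpace Θ]
  [TopologicalSpace X] [MeasurableSpace X] [OpensMeasurableSpace X]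

/-- If `π` has Kullback-Leibler support at `θ` and `π'` does not charge the ball of radius `ε`
around `θ`, then the posteriors stay apart in the Ky Fan metric for samples from `P θ`. -/
theorem Posteriors.not_eventually_posteriorKyFan_lt {P : Θ → ProbabilityMeasure X}
    (R : Posteriors P) (hP : Measurable P) (hP_inj : Function.Injective P)
    (hP_open : IsOpenMap (Set.rangeFactorization P)) {π π' : ProbabilityMeasure Θ} {θ : Θ}
    (hKL : HasKLSupportAt P π θ) {ε ε₂ : ℝ} (hε₂ : 0 < ε₂) (hε₂' : ε₂ < 1) (hε : ε₂ < ε)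
    (hπ' : (π' : Measure Θ) (Metric.ball θ ε) = 0) :
    ¬ ∀ᶠ n in atTop, posteriorKyFan (P θ) (R.onSeq π n) (R.onSeq π' n) < ε₂ := by
  intro hev
  -- Radius `ε - ε₂` is chosen so that an `ε₂`-thickening stays in the ball that `π'` does not
  -- charge.
  have hlim := R.tendsto_measure_compl hP hP_inj hP_open hKL
    (Metric.isOpen_ball (x := θ) (ε := ε - ε₂)) (Metric.mem_ball_self (sub_pos.2 hε))
    (sub_pos.2 hε₂')
  obtain ⟨n, hn, hG⟩ := (hev.and (hlim.eventually_lt_const (sub_pos.2 hε₂'))).exists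
  obtain ⟨e, he0, he, hQ⟩ := exists_of_kyFanDist_lt hn
  set B := Metric.ball θ (ε - ε₂) with hB
  have hBm : MeasurableSet B := Metric.isOpen_ball.measurableSet
  set G : Set (Fin n → X) := {x | ENNReal.ofReal (1 - ε₂) ≤ (R.post π n x : Measure Θ) Bᶜ}
  have hGm : MeasurableSet G := measurableSet_le measurable_const (R.measurable_apply π n hBm.compl)
  have hmap := iidSeqLaw_map (P θ) n
  have hproj : Measurable fun (x : ℕ → X) (i : Fin n) => x i := by fun_prop
  have hac : ∀ᵐ x ∂iidSeqLaw (P θ), (R.onSeq π' n x : Measure Θ) ≪ (π' : Measure Θ) := by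
    have h := R.absolutelyContinuous π' n θ
    rw [← hmap] at h
    exact ae_of_ae_map hproj.aemeasurable h
  have hGQ : iidSeqLaw (P θ) ((fun x (i : Fin n) => x i) ⁻¹' G) < ENNReal.ofReal (1 - ε₂) := by
    rw [← Measure.map_apply hproj hGm, hmap]
    exact (ENNReal.lt_ofReal_iff_toReal_lt (measure_ne_top _ _)).2 hG
  -- Almost surely the posteriors are more than `e` apart or the posterior of `π` is bad: if they
  -- are close, it gives `B` mass at most `ε₂`. The two events have probability at most `e < ε₂` and
  -- less than `1 - ε₂`, too little to cover the space.
  have hcover : ∀ᵐ x ∂iidSeqLaw (P θ), x ∈ Set.univ →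
      x ∈ {x | e < prokhorovDist (R.onSeq π n x) (R.onSeq π' n x)} ∪
        (fun x (i : Fin n) => x i) ⁻¹' G := by
    filter_upwards [hac] with x hx _
    by_contra hcon
    rw [Set.mem_union, not_or] at hcon
    obtain ⟨h1, h2⟩ := hcon
    rw [Set.mem_ofPred_eq, not_lt] at h1
    refine h2 ?_
    have h3 := measure_ball_le_of_prokhorovDist_lt (r := ε - ε₂) hε₂ (h1.trans_lt he) θ
      (by rw [add_sub_cancel]; exact hx hπ')
    change ENNReal.ofReal (1 - ε₂) ≤ (R.onSeq π n x : Measure Θ) Bᶜ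
    rw [prob_compl_eq_one_sub hBm, ENNReal.ofReal_sub _ hε₂.le, ENNReal.ofReal_one]
    exact tsub_le_tsub_left h3 _
  have h1 : (1 : ℝ≥0∞) < 1 := by
    calc (1 : ℝ≥0∞) = iidSeqLaw (P θ) Set.univ := measure_univ.symm
      _ ≤ _ := measure_mono_ae hcover
      _ ≤ _ := measure_union_le _ _
      _ < ENNReal.ofReal ε₂ + ENNReal.ofReal (1 - ε₂) :=
        ENNReal.add_lt_add_of_le_of_lt (ne_top_of_le_ne_top ENNReal.ofReal_ne_top hQ)
          (hQ.trans (ENNReal.ofReal_le_ofReal he.le)) hGQ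
      _ = 1 := by
        rw [← ENNReal.ofReal_add hε₂.le (by linarith)]
        simp
  exact lt_irrefl _ h1

end KyFan

end BayesRobust

/-- A separable metric space whose Borel structure is standard Borel is, up to isometry, the same
as a Borel subset of a Polish metric space. -/
theorem theorem4p3 {Θ X : Type*}
    [MetricSpace Θ] [SecondCountableTopology Θ] [MeasurableSpace Θ] [BorelSpace Θ]
    [StandardBorelSpace Θ]
    [MetricSpace X] [SecondCountableTopology X] [MeasurableSpace X] [BorelSpace X]
    [StandardBorelSpace X]
    (P : Θ → ProbabilityMeasure X) (hP_meas : Measurable P) (hP_inj : Function.Injective P)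
    (hP_dom : BayesRobust.IsDominated P) (hP_open : IsOpenMap (Set.rangeFactorization P))
    (R : BayesRobust.Posteriors P)
    (dX : ProbabilityMeasure X → ProbabilityMeasure X → ℝ)
    (hdX : BayesRobust.IsPseudometric dX)
    (dΘΘ : ProbabilityMeasure (ProbabilityMeasure Θ) →
      ProbabilityMeasure (ProbabilityMeasure Θ) → ℝ)
    (hdΘΘ : BayesRobust.IsPseudometric dΘΘ)
    (hΘ : TotallyBounded (Set.univ : Set Θ))
    (π : ProbabilityMeasure Θ) (hπ : BayesRobust.HasGlobalKLSupport P π)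
    (ρ : ℝ) (hρ : 0 < ρ)
    (hrob : BayesRobust.QualitativelyRobust R BayesRobust.tvDist dX dΘΘ
      BayesRobust.posteriorKyFan (BayesRobust.admissibleSet P ρ π))
    (ε₁ ε₂ δ₁ δ₂ : ℝ) (hε₁ : 0 < ε₁) (hε₂ : 0 < ε₂) (hε₂' : ε₂ < 1) (hδ₁ : 0 < δ₁) (hδ₂ : 0 < δ₂)
    (hδ : BayesRobust.IsTolerance R BayesRobust.tvDist dX dΘΘ
      BayesRobust.posteriorKyFan (BayesRobust.admissibleSet P ρ π) ε₁ ε₂ δ₁ δ₂)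
    (ε : ℝ) (hε : ε₂ < ε) (hN : 2 ≤ BayesRobust.coveringNumber Θ (2 * ε)) :
    min δ₁ ρ ≤ 1 / (BayesRobust.coveringNumber Θ (2 * ε) : ℝ) ∧
      ((∀ (π' : ProbabilityMeasure Θ) (θ : Θ), BayesRobust.tvDist π π' < δ₁ →
          ((π, P θ), (π', P θ)) ∈ BayesRobust.admissibleSet P ρ π) →
        δ₁ ≤ min (1 / (BayesRobust.coveringNumber Θ (2 * ε) : ℝ)) ρ) := by
  have hN0 : BayesRobust.coveringNumber Θ (2 * ε) ≠ 0 := by omega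
  -- Mass at most 1/2 lets the ball be conditioned away, and later keeps `π` far enough from a point
  -- mass at `θ`.
  have hN2 : 1 / (BayesRobust.coveringNumber Θ (2 * ε) : ℝ) ≤ 1 / 2 :=
    one_div_le_one_div_of_le two_pos (by exact_mod_cast hN)
  obtain ⟨θ, hθ⟩ := BayesRobust.exists_ball_measureReal_le (π : Measure Θ) hN0
  have hmin : min δ₁ ρ ≤ 1 / (BayesRobust.coveringNumber Θ (2 * ε) : ℝ) := by
    by_contra! hcon
    obtain ⟨π', hπ', htv⟩ := BayesRobust.exists_measure_eq_zero_tvDist_le π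
      (Metric.isOpen_ball (x := θ) (ε := ε)).measurableSet (by linarith)
    have hlt := (htv.trans hθ).trans_lt hcon
    refine R.not_eventually_posteriorKyFan_lt hP_meas hP_inj hP_open (hπ θ) hε₂ hε₂' hε hπ' ?_
    exact (hδ π (P θ) π' (P θ) ⟨rfl, hlt.trans_le (min_le_right _ _), θ, rfl, rfl⟩
      (hlt.trans_le (min_le_left _ _)) (by rwa [hdX.self])).mono fun n hn => hn.2
  refine ⟨hmin, fun hadm => ?_⟩
  have hle : δ₁ ≤ ρ := by
    by_contra! hlt
    rw [min_eq_right hlt.le] at hmin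
    have hsing : (π : Measure Θ).real {θ} ≤ (π : Measure Θ).real (Metric.ball θ ε) :=
      measureReal_mono (Set.singleton_subset_iff.2 (Metric.mem_ball_self (hε₂.trans hε)))
    -- Both `ρ` and the mass of `{θ}` are at most 1/2 here. Distance exactly `ρ` is below `δ₁` but
    -- fails the strict inequality in `admissibleSet`.
    obtain ⟨π', hπ'⟩ := BayesRobust.exists_tvDist_eq π θ hρ (by linarith)
    exact (hπ'.not_lt) (hadm π' θ (hπ'.trans_lt hlt)).2.1
  exact le_min (by rwa [min_eq_left hle] at hmin) hle
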